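/- Work in max algebra, i.e. over the semiring $(\mathbb{R}_+,\oplus,\times)$ of nonnegative reals with $a\oplus b=\max(a,b)$; matrix products are $(A\otimes B)_{ij}=\max_k a_{ik}b_{kj}$ and $(A\otimes v)_i=\max_j a_{ij}v_j$. Let $n\ge 1$. An eigenvalue of $A\in\mathbb{R}_+^{n\times n}$ is an $\alpha\ge 0$ with $A\otimes v=\alpha v$ for some nonzero $v\in\mathbb{R}_+^n$, and the Perron root $\lambda(A)$ of $A$ is its largest eigenvalue. The digraph of $A$ has nodes $1,\dots,n$ and an edge $(i,j)$ whenever $a_{ij}>0$; $A$ is irreducible if its digraph is strongly connected (so every $1\times 1$ matrix is irreducible), and reducible otherwise. The classes of $A$ are the strongly connected components of its digraph. A class $\mu$ has access to a class $\nu$, written $\mu\to\nu$, if $\mu=\nu$ or there is a path from $\mu$ to $\nu$ in the reduced digraph, whose nodes are the classes and which has an edge from one class to another whenever the digraph of $A$ has an edge from a node of the first to a node of the second. A class $\nu$ is initial if $\mu\to\nu$ implies $\mu=\nu$, and final if $\nu\to\mu$ implies $\mu=\nu$. The Perron root $\alpha_\nu$ of a class $\nu$ is the maximal cycle geometric mean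 $\max_{1\le k\le m}\max_{i_1,\dots,i_k}(a_{i_1i_2}a_{i_2i_3}\cdots a_{i_ki_1})^{1/k}$, where $i_1,\dots,i_k$ range over the nodes of $\nu$ and $m$ is the number of these nodes. A class $\nu$ is spectral if it is initial, or if $\alpha_\nu>0$ and $\alpha_\mu\le\alpha_\nu$ for every class $\mu$ with $\mu\to\nu$. Suppose that $A,B\in\mathbb{R}_+^{n\times n}$ commute, i.e. $A\otimes B=B\otimes A$, and that $B$ is irreducible. Then: (i) the Perron root of every final class and of every initial class of $A$ is $\lambda(A)$, and all final classes of $A$ are spectral; (ii) $\lambda(A)$ is the unique eigenvalue of $A$; (iii) if $A$ is reducible, then at least two distinct classes of $A$ have Perron root $\lambda(A)$. -/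

import Mathlib

open scoped NNReal

namespace MaxAlg

/-- The max-algebraic product of two matrices: `(A ⊗ B) i j = max_k (A i k * B k j)`. -/
noncomputable def mul {ι : Type*} [Fintype ι] (A B : Matrix ι ι ℝ≥0) : Matrix ι ι ℝ≥0 :=
  fun i j => Finset.univ.sup fun k => A i k * B k j

/-- The max-algebraic matrix-vector product: `(A ⊗ v) i = max_j (A i j * v j)`. -/
noncomputable def mulVec {ι : Type*} [Fintype ι] (A : Matrix ι ι ℝ≥0) (v : ι → ℝ≥0) : ι → ℝ≥0 :=
  fun i => Finset.univ.sup fun j => A i j * v j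

/-- The set of max-algebraic eigenvalues of `A`. -/
def eigenvalues {ι : Type*} [Fintype ι] (A : Matrix ι ι ℝ≥0) : Set ℝ≥0 :=
  {α | ∃ v : ι → ℝ≥0, v ≠ 0 ∧ mulVec A v = α • v}

/-- The Perron root of `A`: its largest max-algebraic eigenvalue. -/
noncomputable def perronRoot {ι : Type*} [Fintype ι] (A : Matrix ι ι ℝ≥0) : ℝ≥0 :=
  sSup (eigenvalues A)

/-- The maximal cycle geometric mean of `A`: the maximum of
`(A i₀ i₁ * A i₁ i₂ * ⋯ * A iₖ i₀) ^ (1 / (k + 1))` over all `k + 1 ∈ {1, …, n}` and all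
`i₀, …, iₖ`, where `n` is the order of `A`. The addition in `Fin (k + 1)` is cyclic. -/
noncomputable def maxCycleMean {ι : Type*} [Fintype ι] (A : Matrix ι ι ℝ≥0) : ℝ≥0 :=
  (Finset.range (Fintype.card ι)).sup fun k =>
    Finset.univ.sup fun i : Fin (k + 1) → ι =>
      (∏ l : Fin (k + 1), A (i l) (i (l + 1))) ^ (1 / ((k : ℝ) + 1))

/-- The edges of the digraph associated with `A`. -/
def Edge {ι : Type*} (A : Matrix ι ι ℝ≥0) (i j : ι) : Prop :=
  0 < A i j

/-- There is a path, possibly of length zero, from `i` to `j` in the digraph of `A`. -/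
def NodeAccess {ι : Type*} (A : Matrix ι ι ℝ≥0) : ι → ι → Prop :=
  Relation.ReflTransGen (Edge A)

/-- `A` is irreducible: its digraph is strongly connected (so every `1 × 1` matrix is
irreducible, including the zero matrix). -/
def Irreducible {ι : Type*} (A : Matrix ι ι ℝ≥0) : Prop :=
  ∀ i j : ι, NodeAccess A i j

/-- `A` is reducible: it is not irreducible. -/
def Reducible {ι : Type*} (A : Matrix ι ι ℝ≥0) : Prop :=
  ¬ Irreducible A

/-- Two nodes lie in the same strongly connected component of the digraph of `A`. -/
def nodeSetoid {ι : Type*} (A : Matrix ι ι ℝ≥0) : Setoid ι where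
  r i j := NodeAccess A i j ∧ NodeAccess A j i
  iseqv :=
    { refl := fun _ => ⟨Relation.ReflTransGen.refl, Relation.ReflTransGen.refl⟩
      symm := fun h => ⟨h.2, h.1⟩
      trans := fun h₁ h₂ => ⟨h₁.1.trans h₂.1, h₂.2.trans h₁.2⟩ }

/-- The classes of `A`: the strongly connected components of its digraph. -/
abbrev ClassOf {ι : Type*} (A : Matrix ι ι ℝ≥0) : Type _ :=
  Quotient (nodeSetoid A)

/-- The set of nodes that belong to the class `μ`. -/
def classNodes {ι : Type*} (A : Matrix ι ι ℝ≥0) (μ : ClassOf A) : Set ι :=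
  {i | Quotient.mk (nodeSetoid A) i = μ}

open Classical in
/-- The Perron root of the class `μ`: the maximal cycle mean of the diagonal block of `A`
indexed by `μ`. -/
noncomputable def classRoot {ι : Type*} [Fintype ι] (A : Matrix ι ι ℝ≥0) (μ : ClassOf A) : ℝ≥0 :=
  maxCycleMean (A.submatrix
    (Subtype.val : classNodes A μ → ι) (Subtype.val : classNodes A μ → ι))

/-- The edges of the reduced digraph, whose nodes are the classes of `A`. -/
def ReducedEdge {ι : Type*} (A : Matrix ι ι ℝ≥0) (μ ν : ClassOf A) : Prop :=
  ∃ i ∈ classNodes A μ, ∃ j ∈ classNodes A ν, Edge A i j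

/-- The class `μ` has access to the class `ν`: they are equal or there is a path from `μ` to `ν`
in the reduced digraph. -/
def Access {ι : Type*} (A : Matrix ι ι ℝ≥0) : ClassOf A → ClassOf A → Prop :=
  Relation.ReflTransGen (ReducedEdge A)

/-- A class is initial if no other class has access to it. -/
def IsInitial {ι : Type*} (A : Matrix ι ι ℝ≥0) (ν : ClassOf A) : Prop :=
  ∀ μ : ClassOf A, Access A μ ν → μ = ν

/-- A class is final if it has access to no other class. -/
def IsFinal {ι : Type*} (A : Matrix ι ι ℝ≥0) (ν : ClassOf A) : Prop :=
  ∀ μ : ClassOf A, Access A ν μ → μ = ν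

/-- A class is spectral if it is initial, or if its Perron root is positive and no class that has
access to it has a larger Perron root. -/
def IsSpectral {ι : Type*} [Fintype ι] (A : Matrix ι ι ℝ≥0) (ν : ClassOf A) : Prop :=
  IsInitial A ν ∨
    (0 < classRoot A ν ∧ ∀ μ : ClassOf A, Access A μ ν → classRoot A μ ≤ classRoot A ν)

end MaxAlg

namespace MaxAlg

/-! Since `B` commutes with `A`, applying `B` keeps an eigenvector of `A` in its eigenspace, and
irreducibility of `B` spreads the support to every node; a maximum of such vectors is a positive
eigenvector (`exists_pos_eigenvector`). The transposes satisfy the same hypotheses, which gives a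
positive left eigenvector. Pairing it with any eigenvector makes all eigenvalues equal to one `α`.

A positive eigenvector `w` acts as a diagonal scaling: every cycle mean is at most `α`, and edges
attaining the maximum in their row satisfy `A i j * w j = α * w i`. If `α > 0`, following such edges
from a final class never leaves it, so they close up to a cycle of mean `α`; initial classes are
final for the transpose. For (iii), if `i` has no access to `j`, a final class reached from `i`
differs from an initial class reaching `j`. -/

theorem le_mulVec {ι : Type*} [Fintype ι] (A : Matrix ι ι ℝ≥0) (v : ι → ℝ≥0) (i j : ι) :
    A i j * v j ≤ mulVec A v i :=
  Finset.le_sup (f := fun j => A i j * v j) (Finset.mem_univ j)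

theorem mulVec_le_iff {ι : Type*} [Fintype ι] {A : Matrix ι ι ℝ≥0} {v u : ι → ℝ≥0} :
    mulVec A v ≤ u ↔ ∀ i j, A i j * v j ≤ u i := by
  simp [Pi.le_def, mulVec]

theorem mulVec_mono {ι : Type*} [Fintype ι] (A : Matrix ι ι ℝ≥0) : Monotone (mulVec A) :=
  fun _ _ h => mulVec_le_iff.2 fun i j => (mul_le_mul_right (h j) _).trans (le_mulVec A _ i j)

theorem mulVec_smul {ι : Type*} [Fintype ι] (A : Matrix ι ι ℝ≥0) (c : ℝ≥0) (v : ι → ℝ≥0) :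
    mulVec A (c • v) = c • mulVec A v := by
  ext1 i
  simp only [mulVec, Pi.smul_apply, smul_eq_mul, NNReal.mul_finset_sup]
  exact Finset.sup_congr rfl fun j _ => by ring

theorem mulVec_mulVec {ι : Type*} [Fintype ι] (A B : Matrix ι ι ℝ≥0) (v : ι → ℝ≥0) :
    mulVec A (mulVec B v) = mulVec (mul A B) v := by
  ext1 i
  simp only [mulVec, mul, NNReal.mul_finset_sup, NNReal.finset_sup_mul]
  rw [Finset.sup_comm]
  exact Finset.sup_congr rfl fun j _ => Finset.sup_congr rfl fun k _ => by ring

theorem mulVec_sup {ι κ : Type*} [Fintype ι] (A : Matrix ι ι ℝ≥0) (s : Finset κ)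
    (V : κ → ι → ℝ≥0) :
    (mulVec A fun i => s.sup fun k => V k i) = fun i => s.sup fun k => mulVec A (V k) i := by
  ext1 i
  simp only [mulVec, NNReal.mul_finset_sup]
  exact Finset.sup_comm _ _ _

theorem continuous_mulVec {ι : Type*} [Fintype ι] (A : Matrix ι ι ℝ≥0) :
    Continuous (mulVec A) := by
  refine continuous_pi fun i => Continuous.finset_sup_apply fun j _ => ?_
  fun_prop

theorem mul_transpose {ι : Type*} [Fintype ι] (A B : Matrix ι ι ℝ≥0) :
    mul A.transpose B.transpose = (mul B A).transpose := by
  funext i j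
  simp [mul, Matrix.transpose_apply, mul_comm]

/-! ### Existence of an eigenvalue -/

theorem exists_minimal_subeigenvalue {ι : Type*} [Fintype ι] [Nonempty ι] (A : Matrix ι ι ℝ≥0) :
    ∃ α : ℝ≥0, (∃ w : ι → ℝ≥0, w ≠ 0 ∧ mulVec A w ≤ α • w) ∧
      ∀ (β : ℝ≥0) (w : ι → ℝ≥0), w ≠ 0 → mulVec A w ≤ β • w → α ≤ β := by
  let C : ℝ≥0 := Finset.univ.sup fun i => Finset.univ.sup fun j => A i j
  have hAC : ∀ i j, A i j ≤ C := fun i j =>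
    (Finset.le_sup (f := fun j => A i j) (Finset.mem_univ j)).trans
      (Finset.le_sup (f := fun i => Finset.univ.sup fun j => A i j) (Finset.mem_univ i))
  -- Subeigenvectors are scaled to largest entry 1, which keeps the limit nonzero. The bound `C`
  -- loses nothing: the constant vector 1 already achieves it.
  let K : Set (ℝ≥0 × (ι → ℝ≥0)) := {p | p.1 ∈ Set.Icc 0 C ∧ p.2 ∈ Set.Icc 0 1 ∧
    (∃ i, p.2 i = 1) ∧ ∀ i j, A i j * p.2 j ≤ p.1 * p.2 i}
  have hK : IsCompact K := by
    have h : K = (Set.Icc 0 C ×ˢ Set.Icc 0 1) ∩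
        ((⋃ i, {p : ℝ≥0 × (ι → ℝ≥0) | p.2 i = 1}) ∩ ⋂ i, ⋂ j,
          {p : ℝ≥0 × (ι → ℝ≥0) | A i j * p.2 j ≤ p.1 * p.2 i}) := by
      ext p
      simp only [K, Set.mem_ofPred_eq, Set.mem_inter_iff, Set.mem_prod, Set.mem_iUnion,
        Set.mem_iInter, and_assoc]
    rw [h]
    refine (isCompact_Icc.prod isCompact_Icc).inter_right (IsClosed.inter ?_ ?_)
    · exact isClosed_iUnion_of_finite fun i => isClosed_eq (by fun_prop) (by fun_prop)
    · exact isClosed_iInter fun i => isClosed_iInter fun j =>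
        isClosed_le (by fun_prop) (by fun_prop)
  have hne : K.Nonempty :=
    ⟨(C, 1), ⟨zero_le, le_rfl⟩, ⟨zero_le, le_rfl⟩, ⟨Classical.arbitrary ι, rfl⟩,
      fun i j => by simpa using hAC i j⟩
  obtain ⟨⟨α, w⟩, ⟨hα, -, ⟨i₀, hi₀⟩, hle⟩, hmin⟩ :=
    hK.exists_isMinOn hne continuous_fst.continuousOn
  refine ⟨α, ⟨w, fun h => by simp [h] at hi₀, mulVec_le_iff.2 hle⟩, fun β v hv hβ => ?_⟩
  by_cases hβC : β ≤ C
  · obtain ⟨m, -, hm⟩ := Finset.exists_max_image Finset.univ v Finset.univ_nonempty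
    have hmpos : 0 < v m := by
      obtain ⟨i, hi⟩ := Function.ne_iff.1 hv
      exact (pos_iff_ne_zero.2 hi).trans_le (hm i (Finset.mem_univ i))
    have hmem : (β, (v m)⁻¹ • v) ∈ K := by
      refine ⟨⟨zero_le, hβC⟩, ⟨zero_le, fun i => ?_⟩, ⟨m, ?_⟩, ?_⟩
      · simpa using inv_mul_le_one_of_le₀ (hm i (Finset.mem_univ i)) zero_le
      · simp [hmpos.ne']
      · refine (mulVec_le_iff (u := β • (v m)⁻¹ • v)).1 ?_
        rw [mulVec_smul, smul_comm]
        exact smul_le_smul_of_nonneg_left hβ zero_le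
    exact hmin hmem
  · exact hα.2.trans (not_le.1 hβC).le

/-- With `T = α⁻¹ A` and `c ^ (N + 1) = 1 / 2`, the vector `v = max_{k ≤ N} c⁻ᵏ Tᵏ w` satisfies `T v
≤ c v`: each term moves to the next, and the last becomes `2 T^(N+1) w ≤ w`, the first. -/
theorem exists_smul_subeigenvector {ι : Type*} [Fintype ι] (A : Matrix ι ι ℝ≥0)
    {α : ℝ≥0} (hα : 0 < α) {w : ι → ℝ≥0} (hw : w ≠ 0) (N : ℕ)
    (hN : 2 • (fun v => α⁻¹ • mulVec A v)^[N + 1] w ≤ w) :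
    ∃ β < α, ∃ v : ι → ℝ≥0, v ≠ 0 ∧ mulVec A v ≤ β • v := by
  set T : (ι → ℝ≥0) → ι → ℝ≥0 := fun v => α⁻¹ • mulVec A v with hT
  set c : ℝ≥0 := (1 / 2 : ℝ≥0) ^ (1 / ((N + 1 : ℕ) : ℝ)) with hc
  have hcN : c ^ (N + 1) = 1 / 2 := by
    rw [hc, one_div ((N + 1 : ℕ) : ℝ), NNReal.rpow_inv_natCast_pow _ (Nat.succ_ne_zero N)]
  have hc0 : c ≠ 0 := by
    intro h; rw [h] at hcN; simp at hcN
  have hc1 : c < 1 := by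
    by_contra! h
    have := one_le_pow₀ h (n := N + 1)
    rw [hcN] at this
    exact absurd this (by rw [not_le]; exact NNReal.half_lt_self one_ne_zero)
  have hAT : ∀ v, mulVec A v = α • T v := fun v => by simp [hT, smul_smul, hα.ne']
  let v : ι → ℝ≥0 := fun i => (Finset.range (N + 1)).sup fun k => (c⁻¹ ^ k • T^[k] w) i
  have hle : ∀ k ∈ Finset.range (N + 1), c⁻¹ ^ k • T^[k] w ≤ v := fun k hk i =>
    Finset.le_sup (f := fun k => (c⁻¹ ^ k • T^[k] w) i) hk
  have hwv : w ≤ v := by simpa using hle 0 (by simp)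
  refine ⟨α * c, mul_lt_of_lt_one_right hα hc1, v, fun h => hw ?_, ?_⟩
  · exact le_antisymm (hwv.trans h.le) zero_le
  rw [mulVec_sup]
  intro i
  refine Finset.sup_le fun k hk => ?_
  have key : c⁻¹ ^ (k + 1) • T^[k + 1] w ≤ v := by
    rcases Nat.lt_or_ge (k + 1) (N + 1) with h | h
    · exact hle _ (Finset.mem_range.2 h)
    · obtain rfl : k = N := by have := Finset.mem_range.1 hk; omega
      rw [inv_pow, hcN]
      refine le_trans (le_of_eq ?_) (hN.trans hwv)
      ext1 i
      simp
  have := key i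
  rw [mulVec_smul, hAT, ← Function.iterate_succ_apply' T]
  simp only [Pi.smul_apply, smul_eq_mul] at this ⊢
  calc c⁻¹ ^ k * (α * T^[k + 1] w i) = α * c * (c⁻¹ ^ (k + 1) * T^[k + 1] w i) := by
        rw [pow_succ]; field_simp
    _ ≤ α * c * v i := by gcongr

/-- For the least subeigenvalue `α > 0`, the iterates of `α⁻¹ A` on a subeigenvector decrease to a
fixed point. A zero limit would eventually halve `w`, and so produce a smaller subeigenvalue. -/
theorem eigenvalues_nonempty {ι : Type*} [Fintype ι] [Nonempty ι] (A : Matrix ι ι ℝ≥0) :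
    (eigenvalues A).Nonempty := by
  obtain ⟨α, ⟨w, hw, hle⟩, hmin⟩ := exists_minimal_subeigenvalue A
  rcases (zero_le (a := α)).eq_or_lt with rfl | hα
  · exact ⟨0, w, hw, le_antisymm hle (by simp)⟩
  set T : (ι → ℝ≥0) → ι → ℝ≥0 := fun v => α⁻¹ • mulVec A v with hT
  have hTmono : Monotone T := fun x y h => smul_le_smul_of_nonneg_left (mulVec_mono A h) zero_le
  have hTw : T w ≤ w := by
    have := smul_le_smul_of_nonneg_left hle (zero_le (a := α⁻¹))
    rwa [smul_smul, inv_mul_cancel₀ hα.ne', one_smul] at this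
  have hanti : Antitone fun k => T^[k] w := hTmono.antitone_iterate_of_map_le hTw
  let u : ι → ℝ≥0 := fun i => ⨅ k, T^[k] w i
  have hlim : Filter.Tendsto (fun k => T^[k] w) Filter.atTop (nhds u) :=
    tendsto_pi_nhds.2 fun i =>
      tendsto_atTop_ciInf (fun _ _ h => hanti h i) (OrderBot.bddBelow _)
  have hTcont : Continuous T := (continuous_mulVec A).const_smul α⁻¹
  have hfix : T u = u := isFixedPt_of_tendsto_iterate hlim hTcont.continuousAt
  by_cases hu : u = 0
  · exfalso
    rw [hu] at hlim
    have hev : ∀ᶠ k in Filter.atTop, ∀ i, 2 * T^[k] w i ≤ w i := by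
      refine Filter.eventually_all.2 fun i => ?_
      rcases (zero_le (a := w i)).eq_or_lt with h | h
      · refine Filter.Eventually.of_forall fun k => ?_
        have := hanti (Nat.zero_le k) i
        simp only [Function.iterate_zero, id, ← h] at this
        simp [le_antisymm this zero_le]
      · have h2 : Filter.Tendsto (fun k => 2 * T^[k] w i) Filter.atTop (nhds (2 * 0)) :=
          (tendsto_pi_nhds.1 hlim i).const_mul 2
        rw [mul_zero] at h2
        exact (h2.eventually_lt_const h).mono fun _ h => h.le
    obtain ⟨N, hN⟩ := Filter.eventually_atTop.1 hev
    obtain ⟨β, hβ, v, hv, hle'⟩ := exists_smul_subeigenvector A hα hw N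
      (fun i => by simpa using hN (N + 1) (Nat.le_succ N) i)
    exact absurd (hmin β v hv hle') (not_le.2 hβ)
  · refine ⟨α, u, hu, ?_⟩
    conv_rhs => rw [← hfix]
    simp [hT, smul_smul, hα.ne']

/-! ### Positive eigenvectors and uniqueness of the eigenvalue -/

theorem exists_pos_eigenvector {ι : Type*} [Fintype ι] {A B : Matrix ι ι ℝ≥0}
    (hAB : mul A B = mul B A) (hB : Irreducible B) {α : ℝ≥0} (hα : α ∈ eigenvalues A) :
    ∃ w : ι → ℝ≥0, (∀ i, 0 < w i) ∧ mulVec A w = α • w := by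
  obtain ⟨v, hv, hAv⟩ := hα
  obtain ⟨j, hj⟩ := Function.ne_iff.1 hv
  -- Each application of `B` carries positivity one edge backwards along a path from `i` to `j`.
  have key : ∀ i, ∃ u : ι → ℝ≥0, 0 < u i ∧ mulVec A u = α • u := fun i => by
    induction hB i j using Relation.ReflTransGen.head_induction_on with
    | refl => exact ⟨v, pos_iff_ne_zero.2 hj, hAv⟩
    | head h _ ih =>
      obtain ⟨u, hu, hAu⟩ := ih
      refine ⟨mulVec B u, (mul_pos h hu).trans_le (le_mulVec B u _ _), ?_⟩
      rw [mulVec_mulVec, hAB, ← mulVec_mulVec, hAu, mulVec_smul]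
  choose V hV hAV using key
  refine ⟨fun i => Finset.univ.sup fun k => V k i, fun i => (hV i).trans_le
    (Finset.le_sup (f := fun k => V k i) (Finset.mem_univ i)), ?_⟩
  rw [mulVec_sup]
  ext1 i
  simp [hAV, NNReal.mul_finset_sup]

/-- Evaluate `max u i * A i j * v j` in both orders; it is `α` and also `β` times the pairing of `u`
with `v`, which is positive. -/
theorem eigenvalue_eq_of_left_pos {ι : Type*} [Fintype ι] {A : Matrix ι ι ℝ≥0} {α β : ℝ≥0}
    (hα : α ∈ eigenvalues A) {u : ι → ℝ≥0} (hu : ∀ i, 0 < u i)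
    (hAu : mulVec A.transpose u = β • u) : α = β := by
  obtain ⟨v, hv, hAv⟩ := hα
  obtain ⟨j, hj⟩ := Function.ne_iff.1 hv
  have hpos : 0 < Finset.univ.sup fun i => u i * v i :=
    (mul_pos (hu j) (pos_iff_ne_zero.2 hj)).trans_le
      (Finset.le_sup (f := fun i => u i * v i) (Finset.mem_univ j))
  have h1 : (Finset.univ.sup fun i => u i * mulVec A v i) =
      Finset.univ.sup fun j => mulVec A.transpose u j * v j := by
    simp only [mulVec, NNReal.mul_finset_sup, NNReal.finset_sup_mul]
    rw [Finset.sup_comm]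
    exact Finset.sup_congr rfl fun j _ => Finset.sup_congr rfl fun i _ => by
      rw [Matrix.transpose_apply]; ring
  rw [hAv, hAu] at h1
  have h2 : α * (Finset.univ.sup fun i => u i * v i) =
      β * Finset.univ.sup fun i => u i * v i := by
    rw [NNReal.mul_finset_sup, NNReal.mul_finset_sup]
    convert h1 using 3 <;> simp only [Pi.smul_apply, smul_eq_mul] <;> ring
  exact mul_right_cancel₀ hpos.ne' h2

/-! ### Cycle means -/

theorem maxCycleMean_le {ι : Type*} [Fintype ι] {M : Matrix ι ι ℝ≥0} {α : ℝ≥0} {w : ι → ℝ≥0}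
    (hw : ∀ i, 0 < w i) (h : ∀ i j, M i j * w j ≤ α * w i) : maxCycleMean M ≤ α := by
  refine Finset.sup_le fun k _ => Finset.sup_le fun i _ => ?_
  -- The weights cancel around a cycle.
  have hprod : ∏ l : Fin (k + 1), w (i (l + 1)) = ∏ l, w (i l) :=
    Equiv.prod_comp (Equiv.addRight (1 : Fin (k + 1))) fun l => w (i l)
  have hpos : 0 < ∏ l, w (i l) := Finset.prod_pos fun l _ => hw _
  have hle : (∏ l, M (i l) (i (l + 1))) ≤ α ^ (k + 1) := by
    refine le_of_mul_le_mul_right ?_ hpos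
    calc (∏ l, M (i l) (i (l + 1))) * ∏ l, w (i l)
        = ∏ l, M (i l) (i (l + 1)) * w (i (l + 1)) := by rw [Finset.prod_mul_distrib, hprod]
      _ ≤ ∏ l, α * w (i l) := Finset.prod_le_prod' fun l _ => h _ _
      _ = α ^ (k + 1) * ∏ l, w (i l) := by simp [Finset.prod_mul_distrib]
  calc _ ≤ (α ^ (k + 1)) ^ (1 / ((k : ℝ) + 1)) := NNReal.rpow_le_rpow hle (by positivity)
    _ = α := by
      have := NNReal.pow_rpow_inv_natCast α (Nat.succ_ne_zero k)
      rw [one_div]; exact_mod_cast this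

theorem le_maxCycleMean {ι : Type*} [Fintype ι] [Nonempty ι] {M : Matrix ι ι ℝ≥0} {α : ℝ≥0}
    {w : ι → ℝ≥0} (hw : ∀ i, 0 < w i) (h : ∀ i, ∃ j, M i j * w j = α * w i) :
    α ≤ maxCycleMean M := by
  choose f hf using h
  -- The minimal period is needed, since `maxCycleMean` only sees cycles of length at most
  -- `Fintype.card ι`.
  obtain ⟨x, k, hk, hx⟩ : ∃ x k, k + 1 ≤ Fintype.card ι ∧ f^[k + 1] x = x := by
    have hper : Function.periodicPts f ≠ ∅ := by
      obtain ⟨a, b, hne, hab⟩ :=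
        Finite.exists_ne_map_eq_of_infinite fun n : ℕ => f^[n] (Classical.arbitrary ι)
      wlog hlt : a < b generalizing a b
      · exact this b a hne.symm hab.symm (by omega)
      refine Set.nonempty_iff_ne_empty.1
        ⟨f^[a] (Classical.arbitrary ι), Function.mk_mem_periodicPts (Nat.sub_pos_of_lt hlt) ?_⟩
      rw [Function.IsPeriodicPt, Function.IsFixedPt, ← Function.iterate_add_apply,
        Nat.sub_add_cancel hlt.le]
      exact hab.symm
    obtain ⟨x, hx⟩ := Set.nonempty_iff_ne_empty.2 hper
    have hp := Function.minimalPeriod_pos_of_mem_periodicPts hx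
    refine ⟨x, Function.minimalPeriod f x - 1, ?_, ?_⟩
    · rw [Nat.sub_add_cancel hp]
      have hinj : Function.Injective fun l : Fin (Function.minimalPeriod f x) => f^[l] x :=
        fun a b hab => Fin.ext
          (Function.iterate_injOn_Iio_minimalPeriod a.2 b.2 hab)
      simpa using Fintype.card_le_of_injective _ hinj
    · rw [Nat.sub_add_cancel hp]
      exact Function.iterate_minimalPeriod
  let i : Fin (k + 1) → ι := fun l => f^[l] x
  have hi : ∀ l, i (l + 1) = f (i l) := by
    intro l
    simp only [i, ← Function.iterate_succ_apply' f]
    rcases Fin.eq_castSucc_or_eq_last l with ⟨l, rfl⟩ | rfl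
    · simp
    · simp [hx]
  have hprod : ∏ l : Fin (k + 1), w (i (l + 1)) = ∏ l, w (i l) :=
    Equiv.prod_comp (Equiv.addRight (1 : Fin (k + 1))) fun l => w (i l)
  have hpos : 0 < ∏ l, w (i l) := Finset.prod_pos fun l _ => hw _
  have heq : (∏ l, M (i l) (i (l + 1))) = α ^ (k + 1) := by
    refine mul_right_cancel₀ hpos.ne' ?_
    calc (∏ l, M (i l) (i (l + 1))) * ∏ l, w (i l)
        = ∏ l, M (i l) (i (l + 1)) * w (i (l + 1)) := by rw [Finset.prod_mul_distrib, hprod]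
      _ = ∏ l, α * w (i l) := Finset.prod_congr rfl fun l _ => by rw [hi, hf]
      _ = α ^ (k + 1) * ∏ l, w (i l) := by simp [Finset.prod_mul_distrib]
  have hroot : α = (∏ l, M (i l) (i (l + 1))) ^ (1 / ((k : ℝ) + 1)) := by
    rw [heq, one_div]
    exact_mod_cast (NNReal.pow_rpow_inv_natCast α (Nat.succ_ne_zero k)).symm
  rw [hroot]
  refine le_trans ?_ (Finset.le_sup (Finset.mem_range.2 hk))
  exact Finset.le_sup (f := fun i : Fin (k + 1) → ι =>
    (∏ l, M (i l) (i (l + 1))) ^ (1 / ((k : ℝ) + 1))) (Finset.mem_univ i)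

/-- Traverse each cycle backwards; the substitution `l ↦ -1 - l` matches the edges. -/
theorem maxCycleMean_le_transpose {ι : Type*} [Fintype ι] (M : Matrix ι ι ℝ≥0) :
    maxCycleMean M ≤ maxCycleMean M.transpose := by
  refine Finset.sup_mono_fun fun k _ => Finset.sup_le fun i _ => ?_
  refine le_trans (le_of_eq ?_) (Finset.le_sup (f := fun i : Fin (k + 1) → ι =>
    (∏ l, M.transpose (i l) (i (l + 1))) ^ (1 / ((k : ℝ) + 1)))
      (Finset.mem_univ fun l => i (-l)))
  congr 1
  rw [← Equiv.prod_comp (Equiv.subLeft (-1 : Fin (k + 1))) fun l => M (i l) (i (l + 1))]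
  refine Finset.prod_congr rfl fun l _ => ?_
  simp only [Equiv.subLeft_apply, Matrix.transpose_apply]
  congr 2 <;> abel

theorem maxCycleMean_transpose {ι : Type*} [Fintype ι] (M : Matrix ι ι ℝ≥0) :
    maxCycleMean M.transpose = maxCycleMean M :=
  le_antisymm (maxCycleMean_le_transpose M.transpose) (maxCycleMean_le_transpose M)

/-! ### Access, final and initial classes -/

theorem reducedEdge_mk {ι : Type*} {A : Matrix ι ι ℝ≥0} {i j : ι} (h : Edge A i j) :
    ReducedEdge A (Quotient.mk _ i) (Quotient.mk _ j) :=
  ⟨i, rfl, j, rfl, h⟩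

theorem access_mk_iff {ι : Type*} {A : Matrix ι ι ℝ≥0} {i j : ι} :
    Access A (Quotient.mk _ i) (Quotient.mk _ j) ↔ NodeAccess A i j := by
  constructor
  · intro h
    generalize hν : Quotient.mk (nodeSetoid A) j = ν at h
    induction h generalizing j with
    | refl => exact (Quotient.exact hν.symm).1
    | tail _ h ih =>
      obtain ⟨a, ha, b, hb, hab⟩ := h
      have hbj : NodeAccess A b j := (Quotient.exact (hb.trans hν.symm)).1
      exact ((ih ha).tail hab).trans hbj
  · intro h
    induction h with
    | refl => exact Relation.ReflTransGen.refl
    | tail _ h ih => exact ih.tail (reducedEdge_mk h)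

theorem exists_terminal {ι : Type*} [Finite ι] {r : ι → ι → Prop} (hr : ∀ i, r i i)
    (ht : ∀ i j k, r i j → r j k → r i k) (i : ι) : ∃ j, r i j ∧ ∀ k, r j k → r k j := by
  let _ : Preorder ι := { le := r, le_refl := hr, le_trans := ht }
  obtain ⟨j, hij, hj⟩ := Finite.exists_le_maximal (p := fun _ : ι => True) (a := i) trivial
  exact ⟨j, hij, fun k hk => hj.2 trivial hk⟩

theorem exists_isFinal {ι : Type*} [Finite ι] (A : Matrix ι ι ℝ≥0) (i : ι) :
    ∃ j, NodeAccess A i j ∧ IsFinal A (Quotient.mk _ j) := by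
  obtain ⟨j, hij, hj⟩ := exists_terminal (r := NodeAccess A)
    (fun _ => Relation.ReflTransGen.refl) (fun _ _ _ => Relation.ReflTransGen.trans) i
  refine ⟨j, hij, fun μ => Quotient.inductionOn μ fun k hk => Quotient.sound ?_⟩
  exact ⟨hj k (access_mk_iff.1 hk), access_mk_iff.1 hk⟩

theorem exists_isInitial {ι : Type*} [Finite ι] (A : Matrix ι ι ℝ≥0) (j : ι) :
    ∃ i, NodeAccess A i j ∧ IsInitial A (Quotient.mk _ i) := by
  obtain ⟨i, hij, hi⟩ := exists_terminal (r := fun a b => NodeAccess A b a)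
    (fun _ => Relation.ReflTransGen.refl)
    (fun _ _ _ h₁ h₂ => Relation.ReflTransGen.trans h₂ h₁) j
  refine ⟨i, hij, fun μ => Quotient.inductionOn μ fun k hk => Quotient.sound ?_⟩
  exact ⟨access_mk_iff.1 hk, hi k (access_mk_iff.1 hk)⟩

theorem nonempty_classNodes {ι : Type*} (A : Matrix ι ι ℝ≥0) (ν : ClassOf A) :
    Nonempty (classNodes A ν) := by
  obtain ⟨i, hi⟩ := Quotient.exists_rep ν
  exact ⟨⟨i, hi⟩⟩

/-! ### Perron roots of classes -/

theorem exists_mulVec_eq {ι : Type*} [Fintype ι] (A : Matrix ι ι ℝ≥0) (v : ι → ℝ≥0) (i : ι) :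
    ∃ j, mulVec A v i = A i j * v j := by
  obtain ⟨j, -, hj⟩ := Finset.exists_mem_eq_sup Finset.univ ⟨i, Finset.mem_univ i⟩
    fun j => A i j * v j
  exact ⟨j, hj⟩

theorem exists_edge_of_pos {ι : Type*} [Fintype ι] {A : Matrix ι ι ℝ≥0} {α : ℝ≥0} {w : ι → ℝ≥0}
    (hα : 0 < α) (hw : ∀ i, 0 < w i) (hAw : mulVec A w = α • w) (i : ι) :
    ∃ j, Edge A i j ∧ A i j * w j = α * w i := by
  obtain ⟨j, hj⟩ := exists_mulVec_eq A w i
  have h : A i j * w j = α * w i := by rw [← hj, hAw]; rfl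
  refine ⟨j, ?_, h⟩
  exact pos_of_mul_pos_left (h ▸ mul_pos hα (hw i)) zero_le

theorem classRoot_le {ι : Type*} [Fintype ι] {A : Matrix ι ι ℝ≥0} {α : ℝ≥0} {w : ι → ℝ≥0}
    (hw : ∀ i, 0 < w i) (hAw : mulVec A w = α • w) (ν : ClassOf A) : classRoot A ν ≤ α := by
  classical
  exact maxCycleMean_le (w := fun i : classNodes A ν => w i) (fun i => hw i)
    fun i j => mulVec_le_iff.1 hAw.le i j

theorem classRoot_eq_of_isFinal {ι : Type*} [Fintype ι] {A : Matrix ι ι ℝ≥0} {α : ℝ≥0}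
    {w : ι → ℝ≥0} (hw : ∀ i, 0 < w i) (hAw : mulVec A w = α • w) {ν : ClassOf A}
    (hν : IsFinal A ν) : classRoot A ν = α := by
  classical
  refine le_antisymm (classRoot_le hw hAw ν) ?_
  -- For `α = 0` a maximizing index need not be joined by an edge, so it could lie outside the
  -- class.
  rcases (zero_le (a := α)).eq_or_lt with rfl | hα
  · exact zero_le
  have := nonempty_classNodes A ν
  refine le_maxCycleMean (w := fun i : classNodes A ν => w i) (fun i => hw i) ?_
  rintro ⟨i, rfl⟩
  obtain ⟨j, hij, h⟩ := exists_edge_of_pos hα hw hAw i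
  exact ⟨⟨j, hν _ (Relation.ReflTransGen.single (reducedEdge_mk hij))⟩, h⟩

theorem classRoot_eq_of_isInitial {ι : Type*} [Fintype ι] {A : Matrix ι ι ℝ≥0} {α : ℝ≥0}
    {w u : ι → ℝ≥0} (hw : ∀ i, 0 < w i) (hAw : mulVec A w = α • w) (hu : ∀ i, 0 < u i)
    (hAu : mulVec A.transpose u = α • u) {ν : ClassOf A}
    (hν : IsInitial A ν) : classRoot A ν = α := by
  classical
  refine le_antisymm (classRoot_le hw hAw ν) ?_
  rcases (zero_le (a := α)).eq_or_lt with rfl | hα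
  · exact zero_le
  have := nonempty_classNodes A ν
  rw [classRoot, ← maxCycleMean_transpose]
  refine le_maxCycleMean (w := fun i : classNodes A ν => u i) (fun i => hu i) ?_
  rintro ⟨i, rfl⟩
  obtain ⟨j, hij, h⟩ := exists_edge_of_pos hα hu hAu i
  exact ⟨⟨j, hν _ (Relation.ReflTransGen.single (reducedEdge_mk (A := A) hij))⟩, h⟩

theorem irreducible_transpose {ι : Type*} {B : Matrix ι ι ℝ≥0} (hB : Irreducible B) :
    Irreducible B.transpose :=
  fun i j => Relation.reflTransGen_swap.1 (hB j i)

theorem isSpectral_of_isFinal {ι : Type*} [Fintype ι] {A : Matrix ι ι ℝ≥0} {α : ℝ≥0}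
    {w : ι → ℝ≥0} (hw : ∀ i, 0 < w i) (hAw : mulVec A w = α • w) {ν : ClassOf A}
    (hν : IsFinal A ν) : IsSpectral A ν := by
  have hroot := classRoot_eq_of_isFinal hw hAw hν
  rcases (zero_le (a := α)).eq_or_lt with rfl | hα
  · left
    -- Here `A = 0`, so every class is initial.
    have hA : ∀ i j, ¬ Edge A i j := fun i j h => by
      have := mulVec_le_iff.1 hAw.le i j
      simp only [zero_smul, Pi.zero_apply] at this
      exact absurd this (not_le.2 (mul_pos h (hw j)))
    intro μ h
    rcases Relation.ReflTransGen.cases_head h with h | ⟨_, ⟨i, _, j, _, hij⟩, _⟩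
    · exact h
    · exact absurd hij (hA i j)
  · exact Or.inr ⟨hroot ▸ hα, fun μ _ => hroot ▸ classRoot_le hw hAw μ⟩

end MaxAlg

theorem lemmal (n : ℕ) (hn : 1 ≤ n) (A B : Matrix (Fin n) (Fin n) ℝ≥0)
    (hAB : MaxAlg.mul A B = MaxAlg.mul B A) (hB : MaxAlg.Irreducible B) :
    ((∀ ν : MaxAlg.ClassOf A, MaxAlg.IsFinal A ν →
        MaxAlg.classRoot A ν = MaxAlg.perronRoot A) ∧
      (∀ ν : MaxAlg.ClassOf A, MaxAlg.IsInitial A ν →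
        MaxAlg.classRoot A ν = MaxAlg.perronRoot A) ∧
      (∀ ν : MaxAlg.ClassOf A, MaxAlg.IsFinal A ν → MaxAlg.IsSpectral A ν)) ∧
    MaxAlg.eigenvalues A = {MaxAlg.perronRoot A} ∧
    (MaxAlg.Reducible A →
      ∃ μ ν : MaxAlg.ClassOf A, μ ≠ ν ∧
        MaxAlg.classRoot A μ = MaxAlg.perronRoot A ∧
        MaxAlg.classRoot A ν = MaxAlg.perronRoot A) := by
  have : Nonempty (Fin n) := ⟨⟨0, hn⟩⟩
  obtain ⟨α, hα⟩ := MaxAlg.eigenvalues_nonempty A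
  obtain ⟨β, hβ⟩ := MaxAlg.eigenvalues_nonempty A.transpose
  obtain ⟨w, hw, hAw⟩ := MaxAlg.exists_pos_eigenvector hAB hB hα
  have hABt : MaxAlg.mul A.transpose B.transpose = MaxAlg.mul B.transpose A.transpose := by
    rw [MaxAlg.mul_transpose, MaxAlg.mul_transpose, hAB]
  obtain ⟨u, hu, hAu⟩ :=
    MaxAlg.exists_pos_eigenvector hABt (MaxAlg.irreducible_transpose hB) hβ
  obtain rfl : α = β := MaxAlg.eigenvalue_eq_of_left_pos hα hu hAu
  have heig : MaxAlg.eigenvalues A = {α} :=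
    Set.eq_singleton_iff_unique_mem.2
      ⟨hα, fun γ hγ => MaxAlg.eigenvalue_eq_of_left_pos hγ hu hAu⟩
  have hroot : MaxAlg.perronRoot A = α := by rw [MaxAlg.perronRoot, heig, csSup_singleton]
  rw [hroot]
  have hfinal : ∀ ν, MaxAlg.IsFinal A ν → MaxAlg.classRoot A ν = α :=
    fun ν hν => MaxAlg.classRoot_eq_of_isFinal hw hAw hν
  have hinit : ∀ ν, MaxAlg.IsInitial A ν → MaxAlg.classRoot A ν = α :=
    fun ν hν => MaxAlg.classRoot_eq_of_isInitial hw hAw hu hAu hν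
  refine ⟨⟨hfinal, hinit, fun ν hν => MaxAlg.isSpectral_of_isFinal hw hAw hν⟩, heig, ?_⟩
  intro hred
  obtain ⟨i, j, hij⟩ : ∃ i j, ¬ MaxAlg.NodeAccess A i j := by
    simpa [MaxAlg.Reducible, MaxAlg.Irreducible] using hred
  obtain ⟨f, hif, hf⟩ := MaxAlg.exists_isFinal A i
  obtain ⟨s, hsj, hs⟩ := MaxAlg.exists_isInitial A j
  -- Were the two classes equal, `i` would reach `j` through them.
  refine ⟨_, _, fun h => hij ?_, hfinal _ hf, hinit _ hs⟩
  exact (hif.trans (Quotient.exact h).1).trans hsj
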